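/- Let $A = C^*(p,q \mid p^2=p^*=p,\ q^2=q^*=q)$ be the universal unital $C^*$-algebra generated by two projections $p,q$, and let $A^{\otimes k}$ be its $k$-fold $C^*$-tensor power (with $A^{\otimes 0}=\mathbb{C}$). For $\ell \in \mathbb{N}$ let $\mathcal{A}_\ell = \{1, p, q, pq, qp, pqp, qpq, \dots\} \subseteq A$ be the set of alternating products of $p$ and $q$ with at most $\ell$ factors, and let $\mathcal{A}_\ell^{\otimes k} = \{a_1 \otimes \cdots \otimes a_k \mid a_1,\dots,a_k \in \mathcal{A}_\ell\} \subseteq A^{\otimes k}$. A matrix $M \in M_n(B)$ over a unital $C^*$-algebra $B$ is a magic unitary if $M_{ij}^2 = M_{ij}^* = M_{ij}$ and $\sum_{k} M_{ik} = \sum_{k} M_{kj} = 1$ for all $1 \le i,j \le n$. Let $\mathbb{C}\langle X_n\rangle$ be the free unital associative algebra on the variables $x_{ij}$ ($1\le i,j\le n$), and let $I_n$ be its two-sided ideal generated by $x_{ij}^2 - x_{ij}$, $\sum_{k} x_{ik} - 1$, $\sum_{k} x_{kj} - 1$ ($1 \le i,j \le n$) and $x_{ij}x_{ik}$, $x_{ji}x_{ki}$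 ($1\le i,j,k\le n$, $j \ne k$). A nonzero polynomial $P \in \mathbb{C}\langle X_n\rangle$ is separating for a magic unitary $M$ if $P(M) = 0$ (where $x_{ij}$ is replaced by $M_{ij}$) but $P \notin I_n$. Let $n \in \{5,6\}$ and $k,\ell \in \mathbb{N}$. If $M \in M_n(A^{\otimes k})$ is a magic unitary with all entries $M_{ij} \in \operatorname{span} \mathcal{A}_\ell^{\otimes k}$, then there exists a separating polynomial for $M$. -/

import Mathlib

noncomputable section

/-! ### C*-seminorms on a unital complex *-algebra -/

/-- A C*-seminorm on a unital complex *-algebra `S`: a submultiplicative seminorm satisfying the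
C*-identity `N (x* x) = N x ^ 2`. -/
structure CStarSeminorm (S : Type*) [Ring S] [StarRing S] [Algebra ℂ S] [StarModule ℂ S]
    extends Seminorm ℂ S where
  mul_le' : ∀ x y : S, toFun (x * y) ≤ toFun x * toFun y
  star_mul_self' : ∀ x : S, toFun (star x * x) = toFun x ^ 2

namespace CStarSeminorm

section

variable {S : Type*} [Ring S] [StarRing S] [Algebra ℂ S] [StarModule ℂ S]

instance : CoeFun (CStarSeminorm S) (fun _ => S → ℝ) := ⟨fun N => N.toSeminorm⟩

theorem mul_le (N : CStarSeminorm S) (x y : S) : N (x * y) ≤ N x * N y := N.mul_le' x y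

theorem star_mul_self (N : CStarSeminorm S) (x : S) : N (star x * x) = N x ^ 2 :=
  N.star_mul_self' x

theorem nonneg (N : CStarSeminorm S) (x : S) : 0 ≤ N x := apply_nonneg N.toSeminorm x

theorem add_le (N : CStarSeminorm S) (x y : S) : N (x + y) ≤ N x + N y :=
  map_add_le_add N.toSeminorm x y

theorem smul_eq (N : CStarSeminorm S) (c : ℂ) (x : S) : N (c • x) = ‖c‖ * N x :=
  map_smul_eq_mul N.toSeminorm c x

theorem le_star (N : CStarSeminorm S) (x : S) : N x ≤ N (star x) := by
  have h1 := N.star_mul_self x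
  have h2 := N.mul_le (star x) x
  rcases (N.nonneg x).eq_or_lt with h | h
  · rw [← h]; exact N.nonneg _
  · by_contra hlt
    push Not at hlt
    nlinarith

theorem star_eq (N : CStarSeminorm S) (x : S) : N (star x) = N x :=
  le_antisymm (by simpa using N.le_star (star x)) (N.le_star x)

/-- A self-adjoint idempotent has C*-seminorm at most one. -/
theorem le_one_of_isStarProjection (N : CStarSeminorm S) {x : S} (hx : IsStarProjection x) :
    N x ≤ 1 := by
  have h := N.star_mul_self x
  rw [hx.isSelfAdjoint.star_eq, hx.isIdempotentElem.eq] at h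
  nlinarith [N.nonneg x]

theorem one_le_one (N : CStarSeminorm S) : N 1 ≤ 1 := N.le_one_of_isStarProjection (.one S)

/-- The pullback of a C*-seminorm along a unital *-homomorphism. -/
def comap {T : Type*} [Ring T] [StarRing T] [Algebra ℂ T] [StarModule ℂ T]
    (N : CStarSeminorm S) (f : T →⋆ₐ[ℂ] S) : CStarSeminorm T where
  toSeminorm := N.toSeminorm.comp f.toAlgHom.toLinearMap
  mul_le' x y := by
    change N (f (x * y)) ≤ N (f x) * N (f y)
    rw [map_mul]; exact N.mul_le _ _
  star_mul_self' x := by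
    change N (f (star x * x)) = N (f x) ^ 2
    rw [map_mul, map_star]; exact N.star_mul_self _

/-- The pointwise supremum of a pointwise bounded family of C*-seminorms. -/
def sup (F : Set (CStarSeminorm S)) (hF : ∀ x : S, ∃ C : ℝ, ∀ N ∈ F, N x ≤ C) :
    CStarSeminorm S :=
  have hb : ∀ x : S, BddAbove (Set.range fun N : F => N.1 x) := fun x => by
    obtain ⟨C, hC⟩ := hF x
    exact ⟨C, by rintro _ ⟨N, rfl⟩; exact hC N.1 N.2⟩
  have h0 : ∀ x : S, 0 ≤ ⨆ N : F, N.1 x := fun x => Real.iSup_nonneg fun N => N.1.nonneg x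
  { toSeminorm := Seminorm.of (fun x => ⨆ N : F, N.1 x)
      (fun x y => Real.iSup_le
        (fun N => (N.1.add_le x y).trans (add_le_add (le_ciSup (hb x) N) (le_ciSup (hb y) N)))
        (add_nonneg (h0 x) (h0 y)))
      (fun c x => by
        simp only [smul_eq]
        exact (Real.mul_iSup_of_nonneg (norm_nonneg c) _).symm)
    mul_le' := fun x y => Real.iSup_le
      (fun N => (N.1.mul_le x y).trans
        (mul_le_mul (le_ciSup (hb x) N) (le_ciSup (hb y) N) (N.1.nonneg y) (h0 x)))
      (mul_nonneg (h0 x) (h0 y))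
    star_mul_self' := fun x => by
      change (⨆ N : F, N.1 (star x * x)) = (⨆ N : F, N.1 x) ^ 2
      refine le_antisymm (Real.iSup_le (fun N => ?_) (sq_nonneg _)) ?_
      · rw [N.1.star_mul_self]
        exact pow_le_pow_left₀ (N.1.nonneg x) (le_ciSup (hb x) N) 2
      · have h1 : (⨆ N : F, N.1 x) ≤ Real.sqrt (⨆ N : F, N.1 (star x * x)) :=
          Real.iSup_le (fun N => Real.le_sqrt_of_sq_le
            ((N.1.star_mul_self x).symm.le.trans (le_ciSup (hb (star x * x)) N)))
            (Real.sqrt_nonneg _)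
        calc (⨆ N : F, N.1 x) ^ 2 ≤ Real.sqrt (⨆ N : F, N.1 (star x * x)) ^ 2 :=
              pow_le_pow_left₀ (h0 x) h1 2
          _ = _ := Real.sq_sqrt (h0 _) }

end

/-! ### The C*-algebra obtained from a C*-seminorm -/

section

variable {S : Type*} [Ring S] [StarRing S] [Algebra ℂ S] [StarModule ℂ S]

/-- The *-algebra `S`, viewed as a seminormed algebra via `N`. -/
def Seminormed (_N : CStarSeminorm S) : Type _ := S

variable (N : CStarSeminorm S)

instance : Ring N.Seminormed := inferInstanceAs (Ring S)
instance : StarRing N.Seminormed := inferInstanceAs (StarRing S)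
instance : Algebra ℂ N.Seminormed := inferInstanceAs (Algebra ℂ S)
instance : StarModule ℂ N.Seminormed := inferInstanceAs (StarModule ℂ S)

instance : SeminormedAddCommGroup N.Seminormed :=
  AddGroupSeminorm.toSeminormedAddCommGroup (E := N.Seminormed) N.toSeminorm.toAddGroupSeminorm

instance : SeminormedRing N.Seminormed where
  __ := (inferInstance : Ring N.Seminormed)
  __ := (inferInstance : SeminormedAddCommGroup N.Seminormed)
  norm_mul_le x y := N.mul_le x y

instance : NormedAlgebra ℂ N.Seminormed where
  norm_smul_le c x := (N.smul_eq c x).le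

instance : NormedStarGroup N.Seminormed where
  norm_star_le x := (N.star_eq x).le

/-- The Hausdorff completion of `S` with respect to the C*-seminorm `N`. -/
abbrev Completion : Type _ := UniformSpace.Completion N.Seminormed

instance : NormedAlgebra ℂ N.Completion where
  __ := (inferInstance : Algebra ℂ N.Completion)
  norm_smul_le c x := norm_smul_le c x

/-- The canonical map of `S` into its completion. -/
def coe (x : S) : N.Completion := ((show N.Seminormed from x : N.Seminormed) :
  UniformSpace.Completion N.Seminormed)

theorem norm_coe (x : S) : ‖N.coe x‖ = N x :=
  UniformSpace.Completion.norm_coe (E := N.Seminormed) x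

theorem uniformContinuous_star' : UniformContinuous (star : N.Seminormed → N.Seminormed) :=
  star_isometry.uniformContinuous

instance : Star N.Completion := ⟨UniformSpace.Completion.map (star : N.Seminormed → N.Seminormed)⟩

theorem continuous_star' : Continuous (star : N.Completion → N.Completion) :=
  UniformSpace.Completion.continuous_map

theorem coe_star (x : S) : N.coe (star x) = star (N.coe x) :=
  (UniformSpace.Completion.map_coe N.uniformContinuous_star' x).symm

theorem coe_add (x y : S) : N.coe (x + y) = N.coe x + N.coe y :=
  UniformSpace.Completion.coe_add (α := N.Seminormed) x y

theorem coe_mul (x y : S) : N.coe (x * y) = N.coe x * N.coe y :=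
  UniformSpace.Completion.coe_mul (α := N.Seminormed) x y

theorem coe_one : N.coe 1 = 1 := UniformSpace.Completion.coe_one (α := N.Seminormed)

theorem coe_zero : N.coe 0 = 0 := UniformSpace.Completion.coe_zero (α := N.Seminormed)

theorem coe_smul (c : ℂ) (x : S) : N.coe (c • x) = c • N.coe x :=
  UniformSpace.Completion.coe_smul (X := N.Seminormed) c x

theorem denseRange_coe : DenseRange N.coe :=
  UniformSpace.Completion.denseRange_coe (α := N.Seminormed)

instance : StarRing N.Completion where
  star_involutive x := by
    refine N.denseRange_coe.induction_on x
      (isClosed_eq (N.continuous_star'.comp N.continuous_star') continuous_id) fun a => ?_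
    rw [← coe_star, ← coe_star, star_star]
  star_mul x y := by
    refine N.denseRange_coe.induction_on₂ (p := fun x y => star (x * y) = star y * star x)
      (isClosed_eq (N.continuous_star'.comp continuous_mul)
        ((N.continuous_star'.comp continuous_snd).mul (N.continuous_star'.comp continuous_fst)))
      (fun a b => ?_) x y
    rw [← coe_mul, ← coe_star, ← coe_star, ← coe_star, ← coe_mul, star_mul]
  star_add x y := by
    refine N.denseRange_coe.induction_on₂ (p := fun x y => star (x + y) = star x + star y)
      (isClosed_eq (N.continuous_star'.comp continuous_add)
        ((N.continuous_star'.comp continuous_fst).add (N.continuous_star'.comp continuous_snd)))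
      (fun a b => ?_) x y
    rw [← coe_add, ← coe_star, ← coe_star, ← coe_star, ← coe_add, star_add]

instance : StarModule ℂ N.Completion where
  star_smul c x := by
    refine N.denseRange_coe.induction_on x
      (isClosed_eq (N.continuous_star'.comp (continuous_const_smul c))
        (N.continuous_star'.const_smul (star c))) fun a => ?_
    rw [← coe_smul, ← coe_star, ← coe_star, ← coe_smul, star_smul]

instance : CStarRing N.Completion where
  norm_mul_self_le x := by
    refine N.denseRange_coe.induction_on x
      (isClosed_le (continuous_norm.mul continuous_norm)
        (continuous_norm.comp (N.continuous_star'.mul continuous_id))) fun a => ?_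
    change ‖N.coe a‖ * ‖N.coe a‖ ≤ ‖star (N.coe a) * N.coe a‖
    rw [← coe_star, ← coe_mul, norm_coe, norm_coe, N.star_mul_self, sq]

instance : CStarAlgebra N.Completion where

/-- The canonical *-homomorphism from `S` to its completion. -/
def toCompletion : S →⋆ₐ[ℂ] N.Completion where
  toFun := N.coe
  map_one' := N.coe_one
  map_mul' := N.coe_mul
  map_zero' := N.coe_zero
  map_add' := N.coe_add
  commutes' c := by
    rw [Algebra.algebraMap_eq_smul_one, Algebra.algebraMap_eq_smul_one, coe_smul, coe_one]
  map_star' := N.coe_star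

end

/-- Every C*-seminorm on a C*-algebra is dominated by the norm. -/
theorem le_norm {B : Type*} [CStarAlgebra B] (N : CStarSeminorm B) (x : B) : N x ≤ ‖x‖ := by
  rw [← N.norm_coe x]
  exact NonUnitalStarAlgHom.norm_apply_le N.toCompletion x

end CStarSeminorm

/-! ### The universal unital C*-algebra generated by two projections -/

/-- The free unital complex *-algebra `ℂ⟨p, q⟩` on two self-adjoint generators, indexed by `Bool`:
the monoid algebra of the free monoid, with the conjugate-linear involution reversing words. -/
abbrev FreeStarAlg : Type := MonoidAlgebra ℂ (FreeMonoid Bool)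

namespace FreeStarAlg

/-- The element `c • w` for a scalar `c` and a word `w`. -/
def single (w : FreeMonoid Bool) (c : ℂ) : FreeStarAlg := MonoidAlgebra.single w c

/-- The generators: `gen true` is `p` and `gen false` is `q`. -/
def gen (b : Bool) : FreeStarAlg := single (FreeMonoid.of b) 1

@[elab_as_elim]
theorem induction_single {P : FreeStarAlg → Prop} (x : FreeStarAlg) (h0 : P 0)
    (hadd : ∀ x y, P x → P y → P (x + y)) (hs : ∀ w c, P (single w c)) : P x :=
  MonoidAlgebra.induction_linear (motive := P) x h0 hadd hs

theorem single_mul (v w : FreeMonoid Bool) (c d : ℂ) :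
    single v c * single w d = single (v * w) (c * d) :=
  MonoidAlgebra.single_mul_single ..

theorem smul_single (w : FreeMonoid Bool) (c d : ℂ) : c • single w d = single w (c * d) := by
  change c • MonoidAlgebra.single w d = MonoidAlgebra.single w (c * d)
  simp

/-- The involution as an additive map: conjugate the coefficients and reverse the words. -/
def starHom : FreeStarAlg →+ FreeStarAlg where
  toFun x := MonoidAlgebra.map (starAddEquiv (R := ℂ) : ℂ →+ ℂ)
    (MonoidAlgebra.mapDomain (star : FreeMonoid Bool → FreeMonoid Bool) x)
  map_zero' := by simp
  map_add' x y := by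
    rw [MonoidAlgebra.mapDomain_add, MonoidAlgebra.map_add]

instance : Star FreeStarAlg := ⟨starHom⟩

theorem star_single (w : FreeMonoid Bool) (c : ℂ) :
    star (single w c) = single (star w) (star c) := by
  change MonoidAlgebra.map _ (MonoidAlgebra.mapDomain _ (MonoidAlgebra.single w c)) =
    MonoidAlgebra.single _ _
  simp

theorem star_add' (x y : FreeStarAlg) : star (x + y) = star x + star y := map_add starHom x y

theorem star_zero' : star (0 : FreeStarAlg) = 0 := map_zero starHom

instance : StarRing FreeStarAlg where
  star_involutive x := by
    refine induction_single x ?_ ?_ ?_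
    · rw [star_zero', star_zero']
    · intro x y hx hy; rw [star_add', star_add', hx, hy]
    · intro w c; rw [star_single, star_single, star_star, star_star]
  star_mul x y := by
    refine induction_single x ?_ ?_ ?_
    · rw [zero_mul, star_zero', mul_zero]
    · intro a b ha hb; rw [add_mul, star_add', star_add', mul_add, ha, hb]
    · intro v c
      refine induction_single y ?_ ?_ ?_
      · rw [mul_zero, star_zero', zero_mul]
      · intro a b ha hb; rw [mul_add, star_add', star_add', add_mul, ha, hb]
      · intro w d
        rw [single_mul, star_single, star_single, star_single, single_mul, star_mul, star_mul]
  star_add := star_add'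

instance : StarModule ℂ FreeStarAlg where
  star_smul c x := by
    refine induction_single x ?_ ?_ ?_
    · rw [smul_zero, star_zero, smul_zero]
    · intro a b ha hb; rw [smul_add, star_add, star_add, smul_add, ha, hb]
    · intro w d; rw [smul_single, star_single, star_single, smul_single, star_mul']

theorem star_gen (b : Bool) : star (gen b) = gen b := by
  rw [gen, star_single, FreeMonoid.star_of, _root_.star_one]

/-- The C*-seminorms on `ℂ⟨p, q⟩` which respect the relations `p² = p` and `q² = q`
(the relations `p* = p` and `q* = q` hold already in the free *-algebra). -/
def projectionSeminorms : Set (CStarSeminorm FreeStarAlg) :=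
  {N | ∀ b : Bool, N (gen b * gen b - gen b) = 0}

theorem projectionSeminorms_gen_le_one {N : CStarSeminorm FreeStarAlg}
    (hN : N ∈ projectionSeminorms) (b : Bool) : N (gen b) ≤ 1 := by
  have h1 : N (gen b) ^ 2 ≤ N (gen b) := by
    have h := N.add_le (gen b * gen b - gen b) (gen b)
    rw [hN b, sub_add_cancel, zero_add] at h
    have h2 := N.star_mul_self (gen b)
    rw [star_gen] at h2
    rwa [h2] at h
  nlinarith [N.nonneg (gen b)]

theorem projectionSeminorms_bounded (x : FreeStarAlg) :
    ∃ C : ℝ, ∀ N ∈ projectionSeminorms, N x ≤ C := by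
  refine induction_single x ⟨0, fun N _ => (map_zero N.toSeminorm).le⟩ ?_ ?_
  · rintro x y ⟨C, hC⟩ ⟨D, hD⟩
    exact ⟨C + D, fun N hN => (N.add_le x y).trans (add_le_add (hC N hN) (hD N hN))⟩
  · intro w c
    refine ⟨‖c‖, fun N hN => ?_⟩
    have hw : N (single w 1) ≤ 1 := by
      induction w using FreeMonoid.inductionOn' with
      | one => exact N.one_le_one
      | of_mul b w ih =>
        have h : single (FreeMonoid.of b * w) 1 = gen b * single w 1 := by
          rw [gen, single_mul, one_mul]
        rw [h]
        exact (N.mul_le _ _).trans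
          (mul_le_one₀ (projectionSeminorms_gen_le_one hN b) (N.nonneg _) ih)
    have h : single w c = c • single w 1 := by rw [smul_single, mul_one]
    rw [h, N.smul_eq]
    exact mul_le_of_le_one_right (norm_nonneg c) hw

end FreeStarAlg

/-- The universal unital C*-algebra `C*(p, q | p² = p* = p, q² = q* = q)` generated by two
projections: the completion of `ℂ⟨p, q⟩` with respect to the largest C*-seminorm respecting the
relations. -/
abbrev TwoProj : Type :=
  (CStarSeminorm.sup FreeStarAlg.projectionSeminorms
    FreeStarAlg.projectionSeminorms_bounded).Completion

namespace TwoProj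

/-- The canonical map from `ℂ⟨p, q⟩`. -/
def ofFree : FreeStarAlg →⋆ₐ[ℂ] TwoProj := CStarSeminorm.toCompletion _

/-- The universal projections: `proj true` is `p` and `proj false` is `q`. -/
def proj (b : Bool) : TwoProj := ofFree (FreeStarAlg.gen b)

/-- The alternating word with `m` factors starting with `p` (if `b = true`) or `q`
(if `b = false`): `1, p, pq, pqp, …` and `1, q, qp, qpq, …`. -/
def altWord : Bool → ℕ → TwoProj
  | _, 0 => 1
  | b, m + 1 => proj b * altWord (!b) m

/-- The set `𝒜_m = {1, p, q, pq, qp, …}` of alternating words with at most `m` factors. -/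
def altWords (m : ℕ) : Set TwoProj := {a | ∃ b : Bool, ∃ j ≤ m, a = altWord b j}

end TwoProj

/-! ### Tensor powers of C*-algebras -/

namespace PiTensorProduct

open scoped TensorProduct

variable {k : ℕ} {B : Type*} [Ring B] [StarRing B] [Algebra ℂ B] [StarModule ℂ B]

/-- The conjugate-linear map `b₁ ⊗ ⋯ ⊗ b_k ↦ b₁* ⊗ ⋯ ⊗ b_k*`, as an additive map. -/
def starHom : (⨂[ℂ] _ : Fin k, B) →+ (⨂[ℂ] _ : Fin k, B) :=
  liftAddHom (fun x => star x.1 • tprod ℂ (fun i => star (x.2 i)))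
    (fun r f i hf => by
      have : tprod ℂ (fun i => star (f i)) = 0 :=
        (tprod ℂ).map_coord_zero i (by simp [hf])
      simp [this])
    (fun f => by simp)
    (fun r f i x y => by
      have h : ∀ z : B, (fun j => star (Function.update f i z j)) =
          Function.update (fun j => star (f j)) i (star z) := fun z => by
        ext j; by_cases hj : j = i
        · subst hj; simp
        · simp [hj]
      simp only [h, star_add, MultilinearMap.map_update_add, smul_add])
    (fun r r' f => by simp [add_smul])
    (fun r f i c => by
      have h : ∀ z : B, (fun j => star (Function.update f i z j)) =
          Function.update (fun j => star (f j)) i (star z) := fun z => by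
        ext j; by_cases hj : j = i
        · subst hj; simp
        · simp [hj]
      simp only [h, star_smul, MultilinearMap.map_update_smul, smul_smul, star_mul]
      congr 2
      exact Function.update_eq_self i fun j => star (f j))

instance : Star (⨂[ℂ] _ : Fin k, B) := ⟨starHom⟩

theorem star_smul_tprod (c : ℂ) (f : Fin k → B) :
    star (c • tprod ℂ f) = star c • tprod ℂ (fun i => star (f i)) := by
  have h : c • tprod ℂ f = tprodCoeff ℂ c f := (tprodCoeff_eq_smul_tprod c f).symm
  rw [h]
  rfl

theorem star_tprod (f : Fin k → B) : star (tprod ℂ f) = tprod ℂ (fun i => star (f i)) := by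
  have h := star_smul_tprod 1 f
  rwa [one_smul, _root_.star_one, one_smul] at h

instance : StarRing (⨂[ℂ] _ : Fin k, B) where
  star_involutive x := by
    induction x using PiTensorProduct.induction_on with
    | smul_tprod c f => simp [star_smul_tprod]
    | add x y hx hy =>
      have h : ∀ a b : ⨂[ℂ] _ : Fin k, B, star (a + b) = star a + star b := map_add starHom
      rw [h, h, hx, hy]
  star_add := map_add starHom
  star_mul x y := by
    have h : ∀ a b : ⨂[ℂ] _ : Fin k, B, star (a + b) = star a + star b := map_add starHom
    induction x using PiTensorProduct.induction_on with
    | add a b ha hb => rw [add_mul, h, h, mul_add, ha, hb]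
    | smul_tprod c f =>
      induction y using PiTensorProduct.induction_on with
      | add a b ha hb => rw [mul_add, h, h, add_mul, ha, hb]
      | smul_tprod d g =>
        rw [smul_mul_smul_comm, tprod_mul_tprod, star_smul_tprod, star_smul_tprod,
          star_smul_tprod, smul_mul_smul_comm, tprod_mul_tprod, star_mul]
        congr 2
        ext i
        simp

instance : StarModule ℂ (⨂[ℂ] _ : Fin k, B) where
  star_smul c x := by
    induction x using PiTensorProduct.induction_on with
    | add a b ha hb => rw [smul_add, star_add, star_add, smul_add, ha, hb]
    | smul_tprod d f => rw [smul_smul, star_smul_tprod, star_smul_tprod, smul_smul, star_mul']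

/-- The embedding `b ↦ 1 ⊗ ⋯ ⊗ b ⊗ ⋯ ⊗ 1` of the `i`-th leg, as a *-homomorphism. -/
def singleStarAlgHom (i : Fin k) : B →⋆ₐ[ℂ] (⨂[ℂ] _ : Fin k, B) where
  __ := singleAlgHom (R := ℂ) (A := fun _ : Fin k => B) i
  map_star' b := by
    change tprod ℂ (Pi.mulSingle (M := fun _ : Fin k => B) i (star b)) =
      star (tprod ℂ (Pi.mulSingle (M := fun _ : Fin k => B) i b))
    rw [star_tprod]
    congr 1
    ext j
    by_cases hj : j = i
    · subst hj; simp
    · simp [hj]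

end PiTensorProduct

open scoped TensorProduct in
/-- On an algebraic tensor power of a C*-algebra the C*-seminorms are pointwise bounded. -/
theorem CStarSeminorm.tensor_bounded {k : ℕ} {B : Type*} [CStarAlgebra B]
    (x : ⨂[ℂ] _ : Fin k, B) :
    ∃ C : ℝ, ∀ N ∈ (Set.univ : Set (CStarSeminorm (⨂[ℂ] _ : Fin k, B))), N x ≤ C := by
  induction x using PiTensorProduct.induction_on with
  | add x y hx hy =>
    obtain ⟨C, hC⟩ := hx
    obtain ⟨D, hD⟩ := hy
    exact ⟨C + D, fun N hN => (N.add_le x y).trans (add_le_add (hC N hN) (hD N hN))⟩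
  | smul_tprod c f =>
    refine ⟨‖c‖ * ∏ i, ‖f i‖, fun N _ => ?_⟩
    rw [N.smul_eq]
    refine mul_le_mul_of_nonneg_left ?_ (norm_nonneg c)
    have key : ∀ s : Finset (Fin k),
        N (PiTensorProduct.tprod ℂ (fun i => if i ∈ s then f i else 1)) ≤ ∏ i ∈ s, ‖f i‖ := by
      intro s
      induction s using Finset.induction_on with
      | empty =>
        simp only [Finset.notMem_empty, if_false, Finset.prod_empty]
        exact N.one_le_one
      | insert a s ha ih =>
        have h : PiTensorProduct.tprod ℂ (fun i => if i ∈ insert a s then f i else 1) =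
            PiTensorProduct.singleStarAlgHom a (f a) *
              PiTensorProduct.tprod ℂ (fun i => if i ∈ s then f i else 1) := by
          change _ =
            PiTensorProduct.tprod ℂ (Pi.mulSingle (M := fun _ : Fin k => B) a (f a)) * _
          rw [PiTensorProduct.tprod_mul_tprod]
          congr 1
          ext j
          by_cases hj : j = a
          · subst hj; simp [ha]
          · simp [hj]
        rw [h, Finset.prod_insert ha]
        exact (N.mul_le _ _).trans (mul_le_mul
          ((N.comap (PiTensorProduct.singleStarAlgHom a)).le_norm (f a)) ih (N.nonneg _)
          (norm_nonneg _))
    simpa using key Finset.univ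

open scoped TensorProduct in
/-- The `k`-fold C*-tensor power `B^{⊗k}` of a C*-algebra `B`: the completion of the algebraic
tensor power with respect to the largest C*-seminorm. (For the nuclear C*-algebra `TwoProj` this
is the only C*-tensor power.) -/
abbrev CStarTensorPower (B : Type*) [CStarAlgebra B] (k : ℕ) : Type _ :=
  (CStarSeminorm.sup (Set.univ : Set (CStarSeminorm (⨂[ℂ] _ : Fin k, B)))
    CStarSeminorm.tensor_bounded).Completion

namespace CStarTensorPower

open scoped TensorProduct

variable {B : Type*} [CStarAlgebra B] {k : ℕ}

/-- The canonical map from the algebraic tensor power. -/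
def ofAlg : (⨂[ℂ] _ : Fin k, B) →⋆ₐ[ℂ] CStarTensorPower B k := CStarSeminorm.toCompletion _

/-- The elementary tensor `b₁ ⊗ ⋯ ⊗ b_k`. -/
def tmul (b : Fin k → B) : CStarTensorPower B k := ofAlg (PiTensorProduct.tprod ℂ b)

end CStarTensorPower

/-- The set `𝒜_m^{⊗k}` of elementary tensors of alternating words with at most `m` factors. -/
def altTensors (k m : ℕ) : Set (CStarTensorPower TwoProj k) :=
  {t | ∃ a : Fin k → TwoProj, (∀ i, a i ∈ TwoProj.altWords m) ∧ t = CStarTensorPower.tmul a}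

/-! ### Magic unitaries and separating polynomials -/

/-- A magic unitary: a matrix of projections all of whose rows and columns sum up to `1`. -/
structure IsMagicUnitary {n : ℕ} {B : Type*} [CStarAlgebra B] (M : Matrix (Fin n) (Fin n) B) :
    Prop where
  isStarProjection : ∀ i j, IsStarProjection (M i j)
  row_sum : ∀ i, ∑ k, M i k = 1
  col_sum : ∀ j, ∑ k, M k j = 1

/-- The algebra `ℂ⟨X_n⟩` of noncommutative polynomials in the entries `x_{ij}` of an `n × n`
matrix. -/
abbrev NCPoly (n : ℕ) : Type := FreeAlgebra ℂ (Fin n × Fin n)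

/-- The variable `x_{ij}`. -/
def NCPoly.x {n : ℕ} (i j : Fin n) : NCPoly n := FreeAlgebra.ι ℂ (i, j)

/-- The generators of the magic unitary ideal. -/
inductive MagicRelator (n : ℕ) : NCPoly n → Prop
  | idem (i j : Fin n) : MagicRelator n (NCPoly.x i j ^ 2 - NCPoly.x i j)
  | row_sum (i : Fin n) : MagicRelator n (∑ k, NCPoly.x i k - 1)
  | col_sum (j : Fin n) : MagicRelator n (∑ k, NCPoly.x k j - 1)
  | row_orth (i j k : Fin n) (h : j ≠ k) : MagicRelator n (NCPoly.x i j * NCPoly.x i k)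
  | col_orth (i j k : Fin n) (h : j ≠ k) : MagicRelator n (NCPoly.x j i * NCPoly.x k i)

/-- The magic unitary ideal `I_n`, a two-sided ideal of `ℂ⟨X_n⟩`. -/
def magicIdeal (n : ℕ) : TwoSidedIdeal (NCPoly n) := TwoSidedIdeal.span {P | MagicRelator n P}

/-- The substitution homomorphism `φ_M : ℂ⟨X_n⟩ → B`, `x_{ij} ↦ M_{ij}`. -/
def substHom {n : ℕ} {B : Type*} [Ring B] [Algebra ℂ B] (M : Matrix (Fin n) (Fin n) B) :
    NCPoly n →ₐ[ℂ] B :=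
  FreeAlgebra.lift ℂ fun ij : Fin n × Fin n => M ij.1 ij.2

/-- A nonzero polynomial `P` is separating for `M` if it vanishes at `M` but does not lie in the
magic unitary ideal. -/
structure IsSeparating {n : ℕ} {B : Type*} [CStarAlgebra B] (M : Matrix (Fin n) (Fin n) B)
    (P : NCPoly n) : Prop where
  ne_zero : P ≠ 0
  vanishes : substHom M P = 0
  notMem : P ∉ magicIdeal n

end

/-! The proof compares growth rates. A product of alternating words is again alternating, because
equal neighbouring letters merge, and there are at most `2 * (m + 1)` alternating words with at most
`m` factors. A product of `2m` entries of `M` therefore lies in a space of dimension at most `(2 *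
(2ml + 1)) ^ k`, which is polynomial in `m` (`list_prod_mem_span_altTensors`,
`card_le_of_linearIndependent_altTensors`).

Modulo `I_n`, growth is exponential once `n ≥ 5`: some two monomials of degree two generate a free
monoid whose elements are linearly independent. To see this, it is enough to exhibit one matrix `U`
over some complex algebra that satisfies the relations of `I_n` and has this property
(`exists_isMagicMatrix_linearIndependent`). It is block diagonal: a 2×2 block built from one
idempotent, a 3×3 block built from the diagonal matrix units, and an identity block as padding.

For large `m` the `2 ^ m` words of length `m` in the two monomials become linearly dependent at `M`
but stay independent at `U`. A dependence relation at `M` is a separating polynomial. -/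

noncomputable section

/-! ### Polynomial growth of the spans of alternating words -/

namespace TwoProj

/-- Every seminorm in the family vanishes on the relation, hence so does their supremum, which is
the norm of the completion. -/
theorem proj_mul_self (b : Bool) : proj b * proj b = proj b := by
  rw [← sub_eq_zero, proj, ← map_mul, ← map_sub, ← norm_eq_zero]
  refine (CStarSeminorm.norm_coe _ _).trans ?_
  refine le_antisymm (Real.iSup_le (fun N => (N.2 b).le) le_rfl) (CStarSeminorm.nonneg _ _)

theorem one_mem_altWords (m : ℕ) : (1 : TwoProj) ∈ altWords m := ⟨true, 0, m.zero_le, rfl⟩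

theorem proj_mul_mem_altWords (b : Bool) {m : ℕ} {a : TwoProj} (ha : a ∈ altWords m) :
    proj b * a ∈ altWords (m + 1) := by
  obtain ⟨c, j, hj, rfl⟩ := ha
  cases j with
  | zero => exact ⟨b, 1, by omega, rfl⟩
  | succ j =>
    by_cases h : c = b
    · subst h
      refine ⟨c, j + 1, by omega, ?_⟩
      rw [altWord, ← mul_assoc, proj_mul_self]
    · obtain rfl : c = !b := by revert h; cases b <;> cases c <;> simp
      exact ⟨b, j + 2, by omega, rfl⟩

theorem mul_mem_altWords {m m' : ℕ} {a a' : TwoProj} (ha : a ∈ altWords m)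
    (ha' : a' ∈ altWords m') : a * a' ∈ altWords (m + m') := by
  obtain ⟨b, j, hj, rfl⟩ := ha
  -- The induction runs on the actual length `j`, not on its bound `m`.
  suffices h : altWord b j * a' ∈ altWords (j + m') by
    obtain ⟨c, i, hi, h⟩ := h
    exact ⟨c, i, by omega, h⟩
  clear hj
  induction j generalizing b with
  | zero => rw [altWord, one_mul, zero_add]; exact ha'
  | succ j ih =>
    rw [altWord, mul_assoc, add_right_comm]
    exact proj_mul_mem_altWords b (ih _)

end TwoProj

section AltTensors

variable {k : ℕ}

/-- An enumeration of `altTensors k m`. -/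
def altTensorOf (k m : ℕ) (f : Fin k → Bool × Fin (m + 1)) : CStarTensorPower TwoProj k :=
  CStarTensorPower.tmul fun i => TwoProj.altWord (f i).1 (f i).2

theorem altTensors_subset_range (k m : ℕ) : altTensors k m ⊆ Set.range (altTensorOf k m) := by
  rintro _ ⟨a, ha, rfl⟩
  choose b j hj h using ha
  refine ⟨fun i => (b i, ⟨j i, by have := hj i; omega⟩), ?_⟩
  rw [altTensorOf]
  exact congrArg _ (funext fun i => (h i).symm)

/-- Each leg has two possible first letters and `m + 1` possible lengths. The empty word is counted
twice, which is harmless for an upper bound. -/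
theorem card_le_of_linearIndependent_altTensors {ι : Type*} [Fintype ι] {m : ℕ}
    {v : ι → CStarTensorPower TwoProj k} (hv : LinearIndependent ℂ v)
    (hmem : ∀ i, v i ∈ Submodule.span ℂ (altTensors k m)) :
    Fintype.card ι ≤ (2 * (m + 1)) ^ k := by
  classical
  have h := linearIndependent_le_span' v hv (Set.range (altTensorOf k m)) (by
    rintro _ ⟨i, rfl⟩
    exact Submodule.span_mono (altTensors_subset_range k m) (hmem i))
  rw [Cardinal.mk_fintype, Nat.cast_le] at h
  refine h.trans ((Fintype.card_range_le _).trans ?_)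
  simp

theorem mul_mem_altTensors {m m' : ℕ} {s t : CStarTensorPower TwoProj k}
    (hs : s ∈ altTensors k m) (ht : t ∈ altTensors k m') : s * t ∈ altTensors k (m + m') := by
  obtain ⟨a, ha, rfl⟩ := hs
  obtain ⟨b, hb, rfl⟩ := ht
  refine ⟨a * b, fun i => TwoProj.mul_mem_altWords (ha i) (hb i), ?_⟩
  rw [CStarTensorPower.tmul, CStarTensorPower.tmul, CStarTensorPower.tmul, ← map_mul,
    PiTensorProduct.tprod_mul_tprod]

theorem mul_mem_span_altTensors {m m' : ℕ} {s t : CStarTensorPower TwoProj k}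
    (hs : s ∈ Submodule.span ℂ (altTensors k m)) (ht : t ∈ Submodule.span ℂ (altTensors k m')) :
    s * t ∈ Submodule.span ℂ (altTensors k (m + m')) := by
  have h := Submodule.mul_mem_mul hs ht
  rw [Submodule.span_mul_span] at h
  refine Submodule.span_mono ?_ h
  rintro _ ⟨a, ha, b, hb, rfl⟩
  exact mul_mem_altTensors ha hb

theorem one_mem_altTensors : (1 : CStarTensorPower TwoProj k) ∈ altTensors k 0 := by
  refine ⟨1, fun i => TwoProj.one_mem_altWords 0, ?_⟩
  rw [CStarTensorPower.tmul, ← PiTensorProduct.one_def, map_one]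

theorem list_prod_mem_span_altTensors {m : ℕ} (L : List (CStarTensorPower TwoProj k))
    (hL : ∀ t ∈ L, t ∈ Submodule.span ℂ (altTensors k m)) :
    L.prod ∈ Submodule.span ℂ (altTensors k (L.length * m)) := by
  induction L with
  | nil => simpa using Submodule.subset_span one_mem_altTensors
  | cons t L ih =>
    rw [List.prod_cons, List.length_cons, Nat.succ_mul, add_comm]
    exact mul_mem_span_altTensors (hL t (by simp)) (ih fun s hs => hL s (by simp [hs]))

end AltTensors

theorem exists_pow_lt_two_pow (c k : ℕ) : ∃ m : ℕ, (2 * (m * c + 1)) ^ k < 2 ^ m := by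
  -- For `m ≥ 1` one has `2 * (m * c + 1) ≤ 2 * (c + 1) * m`, so this constant absorbs the
  -- coefficient of `m ^ k`; its extra factor `2` makes the final inequality strict.
  have h := (isLittleO_pow_const_const_pow_of_one_lt (R := ℝ) k one_lt_two).def
    (c := ((2 * (c + 1) : ℝ) ^ k * 2)⁻¹) (by positivity)
  obtain ⟨m, hm, hm1⟩ := (h.and (Filter.eventually_ge_atTop 1)).exists
  refine ⟨m, ?_⟩
  rw [Real.norm_of_nonneg (by positivity), Real.norm_of_nonneg (by positivity),
    le_inv_mul_iff₀ (by positivity)] at hm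
  have h1 : (2 * (m * c + 1)) ^ k ≤ (2 * (c + 1)) ^ k * m ^ k := by
    rw [← mul_pow]
    exact Nat.pow_le_pow_left (by nlinarith) k
  have h2 : (2 * (c + 1)) ^ k * 2 * m ^ k ≤ 2 ^ m := by exact_mod_cast hm
  have h3 : 0 < (2 * (c + 1)) ^ k * m ^ k := by positivity
  nlinarith

/-! ### Magic matrices over algebras without involution -/

/-- A matrix over a ring satisfying the relations of the magic unitary ideal. -/
structure IsMagicMatrix {ι R : Type*} [Fintype ι] [Ring R] (U : Matrix ι ι R) : Prop where
  row : ∀ i, CompleteOrthogonalIdempotents (U i)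
  col : ∀ j, CompleteOrthogonalIdempotents fun i => U i j

namespace IsMagicMatrix

variable {ι κ R : Type*} [Fintype ι] [Fintype κ] [Ring R]

theorem reindex {U : Matrix ι ι R} (hU : IsMagicMatrix U) (e : ι ≃ κ) :
    IsMagicMatrix (Matrix.reindex e e U) where
  row i := (CompleteOrthogonalIdempotents.equiv e.symm).2 (hU.row (e.symm i))
  col j := (CompleteOrthogonalIdempotents.equiv e.symm).2 (hU.col (e.symm j))

theorem one [DecidableEq ι] : IsMagicMatrix (1 : Matrix ι ι R) where
  row i := by
    refine ⟨⟨fun j => ?_, fun j l h => ?_⟩, ?_⟩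
    · by_cases h : i = j <;> simp [IsIdempotentElem, Matrix.one_apply, h]
    · by_cases h1 : i = j <;> simp_all [Matrix.one_apply]
    · simp [Matrix.one_apply]
  col i := by
    refine ⟨⟨fun j => ?_, fun j l h => ?_⟩, ?_⟩
    · by_cases h : j = i <;> simp [IsIdempotentElem, Matrix.one_apply, h]
    · rcases eq_or_ne j i with rfl | h1
      · simp [Matrix.one_apply_ne' h]
      · simp [Matrix.one_apply_ne h1]
    · simp [Matrix.one_apply]

/-- The entries depend only on `i - j`, so every row and every column is a permutation of `e`. -/
theorem circulant [AddCommGroup ι] {e : ι → R} (he : CompleteOrthogonalIdempotents e) :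
    IsMagicMatrix (Matrix.circulant e) where
  row i := (CompleteOrthogonalIdempotents.equiv (Equiv.subLeft i)).2 he
  col j := (CompleteOrthogonalIdempotents.equiv (Equiv.subRight j)).2 he

theorem _root_.CompleteOrthogonalIdempotents.sumElim_zero_right {e : ι → R}
    (he : CompleteOrthogonalIdempotents e) :
    CompleteOrthogonalIdempotents (Sum.elim e (0 : κ → R)) := by
  refine ⟨⟨?_, ?_⟩, ?_⟩
  · rintro (i | i)
    · exact he.idem i
    · exact mul_zero _
  · rintro (i | i) (j | j) h
    · exact he.ortho fun hij => h (congrArg _ hij)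
    · exact mul_zero _
    · exact zero_mul _
    · exact zero_mul _
  · simp [he.complete]

theorem _root_.CompleteOrthogonalIdempotents.sumElim_zero_left {e : κ → R}
    (he : CompleteOrthogonalIdempotents e) :
    CompleteOrthogonalIdempotents (Sum.elim (0 : ι → R) e) := by
  have h := (CompleteOrthogonalIdempotents.equiv (Equiv.sumComm ι κ)).2
    (he.sumElim_zero_right (κ := ι))
  convert h using 1
  ext (i | i) <;> rfl

theorem fromBlocks {U : Matrix ι ι R} {V : Matrix κ κ R} (hU : IsMagicMatrix U)
    (hV : IsMagicMatrix V) : IsMagicMatrix (Matrix.fromBlocks U 0 0 V) where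
  row := by
    rintro (i | i)
    · convert (hU.row i).sumElim_zero_right (κ := κ) using 1
      ext (j | j) <;> rfl
    · convert (hV.row i).sumElim_zero_left (ι := ι) using 1
      ext (j | j) <;> rfl
  col := by
    rintro (i | i)
    · convert (hU.col i).sumElim_zero_right (κ := κ) using 1
      ext (j | j) <;> rfl
    · convert (hV.col i).sumElim_zero_left (ι := ι) using 1
      ext (j | j) <;> rfl

/-- The generators of `I_n` do not mention the involution, so nonmembership can be tested on
matrices whose entries are idempotents, not necessarily self-adjoint, in any complex algebra. -/
theorem substHom_eq_zero {n : ℕ} [Algebra ℂ R] {U : Matrix (Fin n) (Fin n) R}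
    (hU : IsMagicMatrix U) {P : NCPoly n} (hP : P ∈ magicIdeal n) : substHom U P = 0 := by
  have hx : ∀ i j, substHom U (NCPoly.x i j) = U i j := fun i j => FreeAlgebra.lift_ι_apply _ _
  have h : magicIdeal n ≤ TwoSidedIdeal.ker (substHom U) := by
    refine TwoSidedIdeal.span_le.2 fun Q hQ => (TwoSidedIdeal.mem_ker _).2 ?_
    cases hQ with
    | idem i j => rw [map_sub, map_pow, hx, sq, (hU.row i).idem j, sub_self]
    | row_sum i => simp only [map_sub, map_sum, map_one, hx, (hU.row i).complete, sub_self]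
    | col_sum j => simp only [map_sub, map_sum, map_one, hx, (hU.col j).complete, sub_self]
    | row_orth i j k h => rw [map_mul, hx, hx]; exact (hU.row i).ortho h
    | col_orth i j k h => rw [map_mul, hx, hx]; exact (hU.col i).ortho h
  exact (TwoSidedIdeal.mem_ker _).1 (h hP)

end IsMagicMatrix

theorem completeOrthogonalIdempotents_matrixSingle {ι R : Type*} [Fintype ι] [DecidableEq ι]
    [Ring R] : CompleteOrthogonalIdempotents fun i : ι => Matrix.single i i (1 : R) := by
  refine ⟨⟨fun i => ?_, fun i j h => ?_⟩, Matrix.sum_single_one⟩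
  · simp [IsIdempotentElem]
  · exact Matrix.single_mul_single_of_ne _ _ _ _ h _

/-! ### A magic matrix whose entries generate a free monoid -/

namespace FreeStarAlg

open scoped Matrix

/-- The matrix all of whose rows are `(p, q, 1 - p - q)`. -/
def rowMatrix : Matrix (Fin 3) (Fin 3) FreeStarAlg :=
  Matrix.of fun _ => ![gen true, gen false, 1 - gen true - gen false]

/-- The matrix is the all-ones column times a row whose entries sum to `1`. The third entry exists
to achieve this sum, while `p` and `q` remain free. -/
theorem isIdempotentElem_rowMatrix : IsIdempotentElem rowMatrix := by
  ext i j
  simp only [rowMatrix, Matrix.mul_apply, Matrix.of_apply, ← Finset.sum_mul]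
  simp [Fin.sum_univ_three]

/-- The index of the column of `rowMatrix` that contains a given generator. -/
def genIndex (b : Bool) : Fin 3 := if b then 0 else 1

/-- On constant vectors the product acts as left multiplication by a free generator: the matrix unit
selects one coordinate, and `rowMatrix` spreads it back over all coordinates with that generator as
coefficient. -/
theorem rowMatrix_mul_single_mulVec (b : Bool) (a : FreeStarAlg) :
    (rowMatrix * Matrix.single (genIndex b) (genIndex b) 1) *ᵥ (fun _ => a) =
      fun _ => gen b * a := by
  ext i
  rw [← Matrix.mulVec_mulVec, Matrix.single_mulVec]
  cases b <;> simp [rowMatrix, genIndex, Matrix.mulVec, dotProduct, Fin.sum_univ_three]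

theorem list_prod_mulVec_one (L : List Bool) :
    (L.map fun b => rowMatrix * Matrix.single (genIndex b) (genIndex b) 1).prod *ᵥ
      (fun _ => 1) = fun _ : Fin 3 => single (FreeMonoid.ofList L) 1 := by
  induction L with
  | nil => rw [List.map_nil, List.prod_nil, Matrix.one_mulVec]; rfl
  | cons b L ih =>
    rw [List.map_cons, List.prod_cons, ← Matrix.mulVec_mulVec, ih, rowMatrix_mul_single_mulVec,
      gen, single_mul, one_mul]
    rfl

theorem linearIndependent_single :
    LinearIndependent ℂ fun w : FreeMonoid Bool => (single w 1 : FreeStarAlg) :=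
  LinearIndependent.of_comp (MonoidAlgebra.coeffLinearEquiv ℂ).toLinearMap
    (Finsupp.basisSingleOne (R := ℂ)).linearIndependent

/-- Applying a product to the all-ones vector and reading coordinate `0` is linear and recovers the
corresponding word; distinct words are independent in the free algebra. -/
theorem linearIndependent_list_prod (m : ℕ) :
    LinearIndependent ℂ fun w : Fin m → Bool => ((List.ofFn w).map fun b =>
      rowMatrix * Matrix.single (genIndex b) (genIndex b) (1 : FreeStarAlg)).prod := by
  refine LinearIndependent.of_comp
    ((LinearMap.proj 0 : (Fin 3 → FreeStarAlg) →ₗ[ℂ] FreeStarAlg) ∘ₗ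
      (Matrix.mulVecBilin ℂ ℂ).flip (fun _ : Fin 3 => (1 : FreeStarAlg))) ?_
  have h : LinearIndependent ℂ fun w : Fin m → Bool =>
      (single (FreeMonoid.ofList (List.ofFn w)) 1 : FreeStarAlg) :=
    linearIndependent_single.comp _ (FreeMonoid.ofList.injective.comp List.ofFn_injective)
  convert h using 1
  ext1 w
  exact congrFun (list_prod_mulVec_one _) 0

end FreeStarAlg

open FreeStarAlg in
theorem exists_isMagicMatrix_linearIndependent (r : ℕ) :
    ∃ (U : Matrix (Fin (2 + 3 + r)) (Fin (2 + 3 + r)) (Matrix (Fin 3) (Fin 3) FreeStarAlg))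
      (i : Fin (2 + 3 + r)) (j : Bool → Fin (2 + 3 + r) × Fin (2 + 3 + r)), IsMagicMatrix U ∧
      ∀ m, LinearIndependent ℂ fun w : Fin m → Bool =>
        ((List.ofFn w).map fun b => U i i * U (j b).1 (j b).2).prod := by
  let e : (Fin 2 ⊕ Fin 3) ⊕ Fin r ≃ Fin (2 + 3 + r) :=
    (finSumFinEquiv.sumCongr (Equiv.refl _)).trans finSumFinEquiv
  refine ⟨Matrix.reindex e e (Matrix.fromBlocks (Matrix.fromBlocks
    (Matrix.circulant ![rowMatrix, 1 - rowMatrix]) 0 0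
    (Matrix.circulant fun i => Matrix.single i i 1)) 0 0 1), e (.inl (.inl 0)),
    fun b => (e (.inl (.inr (genIndex b))), e (.inl (.inr 0))),
    IsMagicMatrix.reindex (.fromBlocks (.fromBlocks
      (.circulant (.of_isIdempotentElem isIdempotentElem_rowMatrix))
      (.circulant completeOrthogonalIdempotents_matrixSingle)) .one) e, fun m => ?_⟩
  -- The selected entries sit at differences `0 - 0` and `genIndex b - 0` of the two circulants, so
  -- they are `rowMatrix` and a diagonal matrix unit.
  convert linearIndependent_list_prod m using 6 with w
  all_goals simp [Matrix.circulant_apply]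

/-! ### Comparison of the two growth rates -/

/-- A matrix of size at least five with entries in the span of `altTensors k l` has a
separating polynomial. -/
theorem exists_isSeparating_of_mem_span_altTensors (r k l : ℕ)
    (M : Matrix (Fin (2 + 3 + r)) (Fin (2 + 3 + r)) (CStarTensorPower TwoProj k))
    (hspan : ∀ i j, M i j ∈ Submodule.span ℂ (altTensors k l)) :
    ∃ P : NCPoly (2 + 3 + r), IsSeparating M P := by
  obtain ⟨U, i, j, hU, hli⟩ := exists_isMagicMatrix_linearIndependent r
  -- Each letter of a word stands for a product of two entries, whence `l + l`.
  obtain ⟨m, hm⟩ := exists_pow_lt_two_pow (l + l) k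
  let W (w : Fin m → Bool) : NCPoly (2 + 3 + r) :=
    ((List.ofFn w).map fun b => NCPoly.x i i * NCPoly.x (j b).1 (j b).2).prod
  have hW {B : Type} [Ring B] [Algebra ℂ B] (V : Matrix (Fin (2 + 3 + r)) (Fin (2 + 3 + r)) B)
      (w : Fin m → Bool) :
      substHom V (W w) = ((List.ofFn w).map fun b => V i i * V (j b).1 (j b).2).prod := by
    simp [W, map_list_prod, substHom, NCPoly.x, Function.comp_def]
  have hdep : ¬ LinearIndependent ℂ fun w => substHom M (W w) := fun h => by
    refine hm.not_ge ?_
    refine le_trans (by simp) (card_le_of_linearIndependent_altTensors h fun w => ?_)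
    rw [hW]
    have h := list_prod_mem_span_altTensors (m := l + l)
      ((List.ofFn w).map fun b => M i i * M (j b).1 (j b).2) fun t ht => by
        obtain ⟨b, -, rfl⟩ := List.mem_map.1 ht
        exact mul_mem_span_altTensors (hspan _ _) (hspan _ _)
    rwa [List.length_map, List.length_ofFn] at h
  obtain ⟨c, hc, w, hw⟩ := Fintype.not_linearIndependent_iff.1 hdep
  have hmap {B : Type} [Ring B] [Algebra ℂ B]
      (V : Matrix (Fin (2 + 3 + r)) (Fin (2 + 3 + r)) B) :
      substHom V (∑ w, c w • W w) = ∑ w, c w • substHom V (W w) := by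
    simp only [map_sum, map_smul]
  -- The same coefficients, not all zero, cannot give a relation at `U`. This shows both that the
  -- polynomial is nonzero and that it lies outside `I_n`.
  have hne : substHom U (∑ w, c w • W w) ≠ 0 := fun h => by
    rw [hmap] at h
    simp only [hW] at h
    exact hw (Fintype.linearIndependent_iff.1 (hli m) c h w)
  exact ⟨∑ w, c w • W w, fun h => hne (by rw [h, map_zero]), (hmap M).trans hc,
    fun h => hne (hU.substHom_eq_zero h)⟩

end

theorem mainTheorem3 (n : ℕ) (hn : n = 5 ∨ n = 6) (k l : ℕ)
    (M : Matrix (Fin n) (Fin n) (CStarTensorPower TwoProj k)) (hM : IsMagicUnitary M)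
    (hspan : ∀ i j, M i j ∈ Submodule.span ℂ (altTensors k l)) :
    ∃ P : NCPoly n, IsSeparating M P := by
  rcases hn with rfl | rfl
  -- The sizes `5` and `6` are `2 + 3 + r` with padding `r = 0` and `r = 1`.
  · exact exists_isSeparating_of_mem_span_altTensors 0 k l M hspan
  · exact exists_isSeparating_of_mem_span_altTensors 1 k l M hspan
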